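/- Let $\mathcal{E}$ and $\mathcal{E}_*$ be complex separable Hilbert spaces (of arbitrary dimension). Let $L^2_{\mathcal{E}}$ be the space of square integrable $\mathcal{E}$-valued functions on the unit circle $\mathbb{T}$ with normalized Lebesgue measure, let $H^2_{\mathcal{E}}(\mathbb{D})\subset L^2_{\mathcal{E}}$ be the Hardy space (the functions whose negatively indexed Fourier coefficients vanish), and let $L^\infty_{\mathcal{B}(\mathcal{E},\mathcal{E}_*)}$ be the space of essentially bounded, strongly measurable (that is, $e^{it}\mapsto\Phi(e^{it})\eta$ is measurable for each $\eta\in\mathcal{E}$) functions on $\mathbb{T}$ with values in the bounded operators $\mathcal{B}(\mathcal{E},\mathcal{E}_*)$. Let $H^\infty_{\mathcal{B}(\mathcal{E},\mathcal{E}_*)}$ be the space of bounded analytic $\mathcal{B}(\mathcal{E},\mathcal{E}_*)$-valued functions on the open unit disc $\mathbb{D}$, and put $\bar H^\infty_{\mathcal{B}(\mathcal{E},\mathcal{E}_*)}=\{\Psi(\bar z):\Psi\in H^\infty_{\mathcal{B}(\mathcal{E},\mathcal{E}_*)}\}$; the values of such functions on $\mathbb{T}$ are their radial limits, which exist a.e.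 in the strong operator topology. For $\Phi\in L^\infty_{\mathcal{B}(\mathcal{E},\mathcal{E}_*)}$, let $\hat\Phi(n)\in\mathcal{B}(\mathcal{E},\mathcal{E}_*)$, $n\in\mathbb{Z}$, be its Fourier coefficients, $\hat\Phi(n)\eta=\frac1{2\pi}\int_0^{2\pi}e^{-int}\Phi(e^{it})\eta\,dt$, let $$\Phi_+(z)=\sum_{m=0}^\infty\hat\Phi(m)z^m,\qquad \Phi_-(z)=\sum_{m=0}^\infty\hat\Phi(-m)\bar z^m\qquad(z\in\mathbb{D}),$$ and let $T_\Phi:H^2_{\mathcal{E}}(\mathbb{D})\to H^2_{\mathcal{E}_*}(\mathbb{D})$, $T_\Phi h=P_+(\Phi h)$, be the Toeplitz operator with symbol $\Phi$, where $P_+$ is the orthogonal projection of $L^2_{\mathcal{E}_*}$ onto $H^2_{\mathcal{E}_*}(\mathbb{D})$. Suppose that $\Phi\in H^\infty_{\mathcal{B}(\mathcal{E},\mathcal{E}_*)}+\bar H^\infty_{\mathcal{B}(\mathcal{E},\mathcal{E}_*)}$ and that $T_\Phi$ is a nonzero partial isometry, i.e. $T_\Phi\ne0$ and $\|T_\Phi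 h\|=\|h\|$ for all $h\in(\ker T_\Phi)^\perp$. Then: 1. $z\mapsto\Phi_+(z)$ and $z\mapsto\Phi_-(z)^*$ are contractive analytic functions on $\mathbb{D}$ (analytic with values of operator norm at most $1$), the radial limits $\Phi_\pm(e^{it})=\lim_{r\to1^-}\Phi_\pm(re^{it})$ exist in the strong operator topology for a.e. $t$, and the functions $\Phi_+(e^{it})^*\Phi_+(e^{it})$ and $\Phi_-(e^{it})\Phi_-(e^{it})^*$ are constant a.e. on $\mathbb{T}$ (each equal a.e. to a fixed bounded operator). 2. $\hat\Phi(m)^*\hat\Phi(-n)=0$ and $\hat\Phi(-n)\hat\Phi(m)^*=0$ for all integers $m,n\ge1$. -/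

import Mathlib

open MeasureTheory Filter Topology
open scoped ENNReal ComplexConjugate InnerProductSpace

noncomputable section

namespace ToeplitzPI

/-- The unit circle `𝕋`, parametrized by `t ∈ ℝ / 2πℤ`; the point `e^{int}` is `fourier n t`. -/
abbrev Torus : Type := AddCircle (2 * Real.pi)

instance factTwoPiPos : Fact (0 < 2 * Real.pi) := ⟨Real.two_pi_pos⟩

/-- Normalized Lebesgue measure on the circle. -/
abbrev torusMeasure : Measure Torus := AddCircle.haarAddCircle

/-- `L²_E`: square integrable `E`-valued functions on the circle. -/
abbrev L2 (E : Type*) [NormedAddCommGroup E] : Type _ := Lp E 2 torusMeasure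

/-- Representatives of elements of `L^∞_{B(E,F)}`: essentially bounded functions on the circle with
values in the bounded operators, measurable for the strong operator topology (for separable
spaces this is the same as weak operator measurability). -/
structure OpLInfty (E F : Type*) [NormedAddCommGroup E] [InnerProductSpace ℂ E]
    [NormedAddCommGroup F] [InnerProductSpace ℂ F] where
  toFun : Torus → E →L[ℂ] F
  meas : ∀ x : E, AEStronglyMeasurable (fun t => toFun t x) torusMeasure
  bdd : ∃ C : ℝ, ∀ᵐ t ∂torusMeasure, ‖toFun t‖ ≤ C

variable {E F : Type*} [NormedAddCommGroup E] [InnerProductSpace ℂ E] [CompleteSpace E]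
  [NormedAddCommGroup F] [InnerProductSpace ℂ F] [CompleteSpace F]

/-! ### The Hardy space -/

theorem integrable_of_L2 (f : L2 E) : Integrable f torusMeasure :=
  (Lp.memLp f).integrable (by norm_num)

theorem norm_integral_fourier_smul_le (f : L2 E) (n : ℤ) :
    ‖fourierCoeff (f : Torus → E) n‖ ≤ ‖f‖ := by
  have h1 : ‖fourierCoeff (f : Torus → E) n‖ ≤ ∫ t, ‖f t‖ ∂torusMeasure := by
    refine (norm_integral_le_integral_norm _).trans (le_of_eq ?_)
    refine integral_congr_ae (Eventually.of_forall fun t => ?_)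
    have h : ‖fourier (-n) t‖ = 1 := by simpa only [fourier_apply] using Circle.norm_coe _
    simp only [norm_smul, h, one_mul]
  refine h1.trans ?_
  rw [integral_norm_eq_lintegral_enorm (Lp.aestronglyMeasurable f),
    ← eLpNorm_one_eq_lintegral_enorm, Lp.norm_def]
  exact ENNReal.toReal_mono (Lp.eLpNorm_ne_top f)
    (eLpNorm_le_eLpNorm_of_exponent_le (by norm_num) (Lp.aestronglyMeasurable f))

/-- The `n`-th Fourier coefficient `f ↦ (1/2π) ∫ e^{-int} f(t) dt` on `L²_E`. -/
def coeffL2 (E : Type*) [NormedAddCommGroup E] [InnerProductSpace ℂ E] [CompleteSpace E] (n : ℤ) :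
    L2 E →L[ℂ] E :=
  LinearMap.mkContinuous
    { toFun := fun f => fourierCoeff (f : Torus → E) n
      map_add' := fun f g => by
        rw [congrFun (fourierCoeff_congr_ae (Lp.coeFn_add f g)) n]
        exact congrFun (fourierCoeff.add (integrable_of_L2 f) (integrable_of_L2 g)) n
      map_smul' := fun c f => by
        rw [congrFun (fourierCoeff_congr_ae (Lp.coeFn_smul c f)) n]
        exact fourierCoeff.const_smul _ c n }
    1 (fun f => by simpa using norm_integral_fourier_smul_le f n)

/-- `H²_E`, seen inside `L²_E` through its boundary values: the `f ∈ L²_E` whose Fourier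
coefficients of negative index vanish. -/
def H2 (E : Type*) [NormedAddCommGroup E] [InnerProductSpace ℂ E] [CompleteSpace E] :
    Submodule ℂ (L2 E) where
  carrier := {f | ∀ n : ℤ, n < 0 → coeffL2 E n f = 0}
  add_mem' := fun hf hg n hn => by rw [map_add, hf n hn, hg n hn, add_zero]
  zero_mem' := fun n _ => map_zero _
  smul_mem' := fun c f hf n hn => by rw [map_smul, hf n hn, smul_zero]

theorem isClosed_H2 : IsClosed (H2 E : Set (L2 E)) := by
  have h : (H2 E : Set (L2 E)) = ⋂ (n : ℤ) (_ : n < 0), {f | coeffL2 E n f = 0} := by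
    ext f
    simp [H2]
  rw [h]
  exact isClosed_iInter fun n => isClosed_iInter fun _ =>
    isClosed_eq (coeffL2 E n).continuous continuous_const

instance completeSpaceH2 : CompleteSpace (H2 E) := isClosed_H2.completeSpace_coe

/-! ### Laurent and Toeplitz operators -/

theorem OpLInfty.aestronglyMeasurable_apply (Φ : OpLInfty E F) {h : Torus → E}
    (hh : AEStronglyMeasurable h torusMeasure) :
    AEStronglyMeasurable (fun t => Φ.toFun t (h t)) torusMeasure := by
  obtain ⟨g, hg, hgh⟩ := hh
  have hs : ∀ s : SimpleFunc Torus E,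
      AEStronglyMeasurable (fun t => Φ.toFun t (s t)) torusMeasure := by
    intro s
    have he : (fun t => Φ.toFun t (s t)) =
        fun t => ∑ y ∈ s.range, (s ⁻¹' {y}).indicator (fun t => Φ.toFun t y) t := by
      funext t
      rw [Finset.sum_eq_single (s t)]
      · simp
      · intro y _ hy
        simp [Set.indicator, hy.symm]
      · intro hy
        exact absurd (s.mem_range_self t) hy
    rw [he]
    exact Finset.aestronglyMeasurable_fun_sum _
      fun y _ => (Φ.meas y).indicator (s.measurableSet_fiber y)
  have hlim : AEStronglyMeasurable (fun t => Φ.toFun t (g t)) torusMeasure :=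
    aestronglyMeasurable_of_tendsto_ae atTop (fun n => hs (hg.approx n))
      (Eventually.of_forall fun t => ((Φ.toFun t).continuous.tendsto _).comp (hg.tendsto_approx t))
  refine hlim.congr ?_
  filter_upwards [hgh] with t ht
  rw [ht]

theorem OpLInfty.memLp_apply (Φ : OpLInfty E F) (h : L2 E) :
    MemLp (fun t => Φ.toFun t (h t)) 2 torusMeasure := by
  obtain ⟨C, hC⟩ := Φ.bdd
  refine (Lp.memLp h).of_le_mul (c := C)
    (Φ.aestronglyMeasurable_apply (Lp.aestronglyMeasurable h)) ?_
  filter_upwards [hC] with t ht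
  exact (Φ.toFun t).le_of_opNorm_le ht _

/-- The Laurent operator `L_Φ h = Φ h` from `L²_E` to `L²_F`. -/
def laurent (Φ : OpLInfty E F) : L2 E →L[ℂ] L2 F :=
  LinearMap.mkContinuousOfExistsBound
    { toFun := fun h => (Φ.memLp_apply h).toLp
      map_add' := fun f g => by
        rw [← MemLp.toLp_add]
        refine MemLp.toLp_congr _ _ ?_
        filter_upwards [Lp.coeFn_add f g] with t ht
        rw [ht]
        exact map_add (Φ.toFun t) _ _
      map_smul' := fun c f => by
        rw [RingHom.id_apply, ← MemLp.toLp_const_smul]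
        refine MemLp.toLp_congr _ _ ?_
        filter_upwards [Lp.coeFn_smul c f] with t ht
        rw [ht]
        exact map_smul (Φ.toFun t) _ _ }
    (by
      obtain ⟨C, hC⟩ := Φ.bdd
      refine ⟨C, fun h => Lp.norm_le_mul_norm_of_ae_le_mul ?_⟩
      filter_upwards [hC, (Φ.memLp_apply h).coeFn_toLp] with t ht ht'
      rw [LinearMap.coe_mk, AddHom.coe_mk, ht']
      exact (Φ.toFun t).le_of_opNorm_le ht _)

/-- The Toeplitz operator `T_Φ h = P_+ (Φ h)` from `H²_E` to `H²_F`. -/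
def toeplitz (Φ : OpLInfty E F) : H2 E →L[ℂ] H2 F :=
  (H2 F).orthogonalProjectionOnto ∘L laurent Φ ∘L (H2 E).subtypeL

/-- `T` is a partial isometry: `‖T h‖ = ‖h‖` for all `h ∈ (ker T)ᗮ`. -/
def IsPartialIsometry {H K : Type*} [NormedAddCommGroup H] [InnerProductSpace ℂ H]
    [NormedAddCommGroup K] [InnerProductSpace ℂ K] (T : H →L[ℂ] K) : Prop :=
  ∀ h ∈ (LinearMap.ker T.toLinearMap)ᗮ, ‖T h‖ = ‖h‖

/-! ### Fourier coefficients of operator valued symbols -/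

theorem OpLInfty.integrable_apply (Φ : OpLInfty E F) (x : E) :
    Integrable (fun t => Φ.toFun t x) torusMeasure := by
  obtain ⟨C, hC⟩ := Φ.bdd
  refine Integrable.of_bound (Φ.meas x) (C * ‖x‖) ?_
  filter_upwards [hC] with t ht
  exact (Φ.toFun t).le_of_opNorm_le ht _

/-- The `n`-th Fourier coefficient `Φ̂(n) ∈ B(E,F)`, given by
`Φ̂(n) x = (1/2π) ∫ e^{-int} Φ(e^{it}) x dt`. -/
def OpLInfty.coeff (Φ : OpLInfty E F) (n : ℤ) : E →L[ℂ] F :=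
  LinearMap.mkContinuousOfExistsBound
    { toFun := fun x => fourierCoeff (fun t => Φ.toFun t x) n
      map_add' := fun x y => by
        simp only [map_add]
        exact congrFun (fourierCoeff.add (Φ.integrable_apply x) (Φ.integrable_apply y)) n
      map_smul' := fun c x => by
        simp only [map_smul]
        exact fourierCoeff.const_smul _ c n }
    (by
      obtain ⟨C, hC⟩ := Φ.bdd
      refine ⟨C, fun x => ?_⟩
      have h := norm_integral_le_of_norm_le_const (μ := torusMeasure)
        (f := fun t => fourier (-n) t • Φ.toFun t x) (C := C * ‖x‖) (by
          filter_upwards [hC] with t ht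
          have h1 : ‖fourier (-n) t‖ = 1 := by simpa only [fourier_apply] using Circle.norm_coe _
          rw [norm_smul, h1, one_mul]
          exact (Φ.toFun t).le_of_opNorm_le ht x)
      simpa [fourierCoeff] using h)

/-- The analytic part `Φ_+(z) = ∑_{m ≥ 0} Φ̂(m) z^m`, for `|z| < 1`. -/
def OpLInfty.plus (Φ : OpLInfty E F) (z : ℂ) : E →L[ℂ] F :=
  ∑' m : ℕ, z ^ m • Φ.coeff (m : ℤ)

/-- The co-analytic part `Φ_-(z) = ∑_{m ≥ 0} Φ̂(-m) z̄^m`, for `|z| < 1`. -/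
def OpLInfty.minus (Φ : OpLInfty E F) (z : ℂ) : E →L[ℂ] F :=
  ∑' m : ℕ, (conj z) ^ m • Φ.coeff (-(m : ℤ))

/-! ### Bounded analytic functions on the disc -/

/-- `Θ ∈ H^∞_{B(E,F)}`: `Θ` is analytic and bounded on the open unit disc. -/
def MemHInfty (Θ : ℂ → E →L[ℂ] F) : Prop :=
  DifferentiableOn ℂ Θ (Metric.ball 0 1) ∧ ∃ C : ℝ, ∀ z ∈ Metric.ball (0 : ℂ) 1, ‖Θ z‖ ≤ C

/-- `Θ` is a contractive analytic function on the open unit disc. -/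
def IsContractiveAnalytic (Θ : ℂ → E →L[ℂ] F) : Prop :=
  DifferentiableOn ℂ Θ (Metric.ball 0 1) ∧ ∀ z ∈ Metric.ball (0 : ℂ) 1, ‖Θ z‖ ≤ 1

/-- `θ` is the boundary function of `Θ`: for almost every `t`, the operators `Θ(r e^{it})` converge
to `θ(t)` in the strong operator topology as `r → 1⁻`. -/
def IsBoundaryFunction (Θ : ℂ → E →L[ℂ] F) (θ : Torus → E →L[ℂ] F) : Prop :=
  ∀ᵐ t ∂torusMeasure, ∀ x : E,
    Tendsto (fun r : ℝ => Θ ((r : ℂ) * fourier 1 t) x) (𝓝[<] 1) (𝓝 (θ t x))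

/-- `Φ ∈ H^∞ + H̄^∞`, where `H̄^∞` consists of the functions `Ψ(z̄)` with `Ψ ∈ H^∞`. -/
def OpLInfty.MemHInftyAddConj (Φ : OpLInfty E F) : Prop :=
  ∃ Θ Ψ : ℂ → E →L[ℂ] F, MemHInfty Θ ∧ MemHInfty Ψ ∧
    ∃ θ ψ : Torus → E →L[ℂ] F, IsBoundaryFunction Θ θ ∧
      IsBoundaryFunction (fun z => Ψ (conj z)) ψ ∧
      ∀ᵐ t ∂torusMeasure, Φ.toFun t = θ t + ψ t

end ToeplitzPI

end

noncomputable section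

namespace ToeplitzPI

local postfix:max "†" => ContinuousLinearMap.adjoint

/-! Everything rests on the relation R† T S = T, where S and R are the shifts on the two Hardy
spaces and T is the Toeplitz operator. If h lies in the initial space of the partial isometry T,
expanding ‖R T h − T S h‖² gives a number ≤ 0. So T S h = R T h and S h stays in the initial space
(`IsToeplitzFor.apply_shift`). The hypotheses are self-adjoint, so T† behaves in the same way, and
each result on Φ_+ becomes one on Φ_-^*.

Constants are orthogonal to the range of the shift, so T maps them to wandering vectors: T x ⟂ R^k T
x' for k ≥ 1. This has two consequences. A wandering vector u of the shift satisfies ‖u(w)‖ ≤ ‖u‖ on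
the disc (`norm_tsum_coeffL2_le`), hence Φ_+ is contractive. All nonzero Fourier coefficients of
⟪Φ_+ x, Φ_+ x'⟫ vanish on the circle, hence Φ_+^* Φ_+ is constant (`ae_adjoint_comp_self_eq`). The
assumption H^∞ + H̄^∞ enters through the radial limits.

For the products, T S − R T takes constant values, given by the coefficients Φ̂(−n), and T x' ⟂
R^{m+1} (T S − R T) h (`inner_coeff_eq_zero`). -/

theorem le_of_sq_le_mul {a b : ℝ} (hb : 0 ≤ b) (h : a ^ 2 ≤ b * a) : a ≤ b := by
  by_contra! hlt
  nlinarith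

/-! ### Partial isometries of Toeplitz type between spaces with isometries. -/

section Abstract

variable {H K : Type*} [NormedAddCommGroup H] [InnerProductSpace ℂ H] [CompleteSpace H]
  [NormedAddCommGroup K] [InnerProductSpace ℂ K] [CompleteSpace K]

/-- `T T† T = T`, the algebraic form of being a partial isometry. -/
def IsAlgPartialIsometry (T : H →L[ℂ] K) : Prop := ∀ h, T (T† (T h)) = T h

/-- `R† T S = T` in weak form: `T` is a Toeplitz operator with respect to `S` and `R`. -/
def IsToeplitzFor (S : H →L[ℂ] H) (R : K →L[ℂ] K) (T : H →L[ℂ] K) : Prop :=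
  ∀ k h, ⟪R k, T (S h)⟫_ℂ = ⟪k, T h⟫_ℂ

/-- By polarization T preserves inner products on (ker T)ᗮ, so T† T is the identity there; the
component in ker T contributes nothing. -/
theorem IsPartialIsometry.isAlg {T : H →L[ℂ] K} (hT : IsPartialIsometry T) :
    IsAlgPartialIsometry T := by
  intro h
  set M := (LinearMap.ker T.toLinearMap)ᗮ with hM
  have hker : ∀ q, q ∈ Mᗮ → T q = 0 := by
    intro q hq
    have hc : IsClosed ((LinearMap.ker T.toLinearMap : Submodule ℂ H) : Set H) :=
      T.isClosed_ker
    have := hc.completeSpace_coe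
    rw [hM, Submodule.orthogonal_orthogonal] at hq
    exact hq
  have hin : ∀ a ∈ M, ∀ b ∈ M, ⟪T a, T b⟫_ℂ = ⟪a, b⟫_ℂ := by
    intro a ha b hb
    let V : M →ₗᵢ[ℂ] K := ⟨T.toLinearMap ∘ₗ M.subtype, fun x => hT x x.2⟩
    exact V.inner_map_map ⟨a, ha⟩ ⟨b, hb⟩
  obtain ⟨p, hp, q, hq, rfl⟩ := M.exists_add_mem_mem_orthogonal h
  have hTp : T† (T p) = p := by
    refine ext_inner_left ℂ fun v => ?_
    rw [ContinuousLinearMap.adjoint_inner_right]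
    obtain ⟨a, ha, b, hb, rfl⟩ := M.exists_add_mem_mem_orthogonal v
    rw [map_add, hker b hb, add_zero, hin a ha p hp, inner_add_left,
      Submodule.inner_left_of_mem_orthogonal hp hb, add_zero]
  rw [map_add, hker q hq, add_zero, hTp]

variable {T : H →L[ℂ] K}

theorem IsAlgPartialIsometry.adjoint (hT : IsAlgPartialIsometry T) :
    IsAlgPartialIsometry (T†) := by
  intro k
  refine ext_inner_left ℂ fun v => ?_
  rw [ContinuousLinearMap.adjoint_adjoint, ContinuousLinearMap.adjoint_inner_right,
    ← ContinuousLinearMap.adjoint_inner_left T, ContinuousLinearMap.adjoint_inner_right T _ k, hT,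
    ContinuousLinearMap.adjoint_inner_right]

theorem IsAlgPartialIsometry.norm_adjoint_apply (hT : IsAlgPartialIsometry T) (h : H) :
    ‖T† (T h)‖ = ‖T h‖ := by
  have h1 : ⟪T† (T h), T† (T h)⟫_ℂ = ⟪T h, T h⟫_ℂ := by
    rw [ContinuousLinearMap.adjoint_inner_right, hT]
  rw [inner_self_eq_norm_sq_to_K, inner_self_eq_norm_sq_to_K] at h1
  have h2 : ‖T† (T h)‖ ^ 2 = ‖T h‖ ^ 2 := by exact_mod_cast h1
  exact (pow_left_inj₀ (norm_nonneg _) (norm_nonneg _) two_ne_zero).1 h2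

theorem inner_adjoint_apply_self (T : H →L[ℂ] K) (h : H) :
    RCLike.re ⟪h, T† (T h)⟫_ℂ = ‖T h‖ ^ 2 := by
  rw [ContinuousLinearMap.adjoint_inner_right, inner_self_eq_norm_sq]

theorem IsAlgPartialIsometry.norm_apply_le (hT : IsAlgPartialIsometry T) (h : H) :
    ‖T h‖ ≤ ‖h‖ := by
  have h1 : ‖T h‖ ^ 2 ≤ ‖h‖ * ‖T h‖ := by
    rw [← inner_adjoint_apply_self T h, ← hT.norm_adjoint_apply h]
    exact re_inner_le_norm _ _
  exact le_of_sq_le_mul (norm_nonneg _) h1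

/-- A vector whose norm is preserved lies in the initial space: ‖h − T† T h‖² = ‖h‖² − ‖T h‖². -/
theorem IsAlgPartialIsometry.adjoint_apply_of_norm_eq (hT : IsAlgPartialIsometry T) {h : H}
    (hh : ‖T h‖ = ‖h‖) : T† (T h) = h := by
  have h1 := norm_sub_sq (𝕜 := ℂ) h (T† (T h))
  rw [inner_adjoint_apply_self, hT.norm_adjoint_apply, hh] at h1
  have h2 : ‖h - T† (T h)‖ = 0 := by
    have : ‖h - T† (T h)‖ ^ 2 = 0 := by linarith
    simpa using this
  exact (sub_eq_zero.1 (norm_eq_zero.1 h2)).symm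

variable {S : H →L[ℂ] H} {R : K →L[ℂ] K}

theorem IsToeplitzFor.adjoint (hTS : IsToeplitzFor S R T) : IsToeplitzFor R S (T†) := by
  intro h k
  rw [ContinuousLinearMap.adjoint_inner_right, ContinuousLinearMap.adjoint_inner_right,
    ← inner_conj_symm, hTS, inner_conj_symm]

/-- Key step. The Toeplitz relation turns the cross term of ‖R T h − T S h‖² into ‖T h‖² = ‖h‖², and
‖T S h‖ ≤ ‖h‖, so the square is at most 0. -/
theorem IsToeplitzFor.apply_shift (hTS : IsToeplitzFor S R T) (hT : IsAlgPartialIsometry T)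
    (hS : ∀ h, ‖S h‖ = ‖h‖) (hR : ∀ k, ‖R k‖ = ‖k‖) {h : H} (hh : T† (T h) = h) :
    T (S h) = R (T h) ∧ T† (T (S h)) = S h := by
  have hn : ‖T h‖ = ‖h‖ := by rw [← hT.norm_adjoint_apply, hh]
  have h1 := norm_sub_sq (𝕜 := ℂ) (R (T h)) (T (S h))
  rw [hTS, inner_self_eq_norm_sq, hR, hn] at h1
  have h2 : ‖T (S h)‖ ≤ ‖h‖ := (hT.norm_apply_le _).trans (hS h).le
  have h3 : ‖R (T h) - T (S h)‖ = 0 := by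
    have : ‖R (T h) - T (S h)‖ ^ 2 ≤ 0 := by
      nlinarith [norm_nonneg (T (S h)), norm_nonneg h]
    have h4 : ‖R (T h) - T (S h)‖ ^ 2 = 0 := le_antisymm this (sq_nonneg _)
    simpa using h4
  have h4 : T (S h) = R (T h) := (sub_eq_zero.1 (norm_eq_zero.1 h3)).symm
  exact ⟨h4, hT.adjoint_apply_of_norm_eq (by rw [h4, hR, hn, hS])⟩

theorem IsToeplitzFor.apply_shift_pow (hTS : IsToeplitzFor S R T) (hT : IsAlgPartialIsometry T)
    (hS : ∀ h, ‖S h‖ = ‖h‖) (hR : ∀ k, ‖R k‖ = ‖k‖) {h : H} (hh : T† (T h) = h) (n : ℕ) :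
    T (S^[n] h) = R^[n] (T h) ∧ T† (T (S^[n] h)) = S^[n] h := by
  induction n with
  | zero => simpa using hh
  | succ n ih =>
    have h1 := hTS.apply_shift hT hS hR ih.2
    simp only [Function.iterate_succ_apply']
    exact ⟨by rw [h1.1, ih.1], h1.2⟩

/-- The images of vectors orthogonal to the range of `S` are wandering vectors of `R`. -/
theorem IsToeplitzFor.inner_apply_pow (hTS : IsToeplitzFor S R T) (hT : IsAlgPartialIsometry T)
    (hS : ∀ h, ‖S h‖ = ‖h‖) (hR : ∀ k, ‖R k‖ = ‖k‖) {e : H} (he : ∀ h, ⟪e, S h⟫_ℂ = 0)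
    (e' : H) (n : ℕ) : ⟪T e, R^[n + 1] (T e')⟫_ℂ = 0 := by
  -- Replacing e' by its projection onto the initial space does not change T e' and makes the
  -- intertwining available.
  have h1 := hTS.apply_shift_pow hT hS hR (h := T† (T e')) (by rw [hT]) (n + 1)
  rw [hT] at h1
  rw [← h1.1, ← ContinuousLinearMap.adjoint_inner_right, h1.2, Function.iterate_succ_apply', he]

/-- The defect T S h − R T h lies in the range of T, because R T h = T S T† T h. There T†
intertwines R with S, so moving T to the other side leaves e against a vector S(…). -/
theorem IsToeplitzFor.inner_apply_sub (hTS : IsToeplitzFor S R T) (hT : IsAlgPartialIsometry T)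
    (hS : ∀ h, ‖S h‖ = ‖h‖) (hR : ∀ k, ‖R k‖ = ‖k‖) {e : H} (he : ∀ h, ⟪e, S h⟫_ℂ = 0)
    (h : H) (m : ℕ) : ⟪T e, R^[m + 1] (T (S h) - R (T h))⟫_ℂ = 0 := by
  have h1 := (hTS.apply_shift hT hS hR (h := T† (T h)) (by rw [hT])).1
  rw [hT] at h1
  have h2 : T† (T (S h - S (T† (T h)))) = T† (T (S h) - R (T h)) := by
    rw [map_sub, h1]
  have h3 := hTS.adjoint.apply_shift_pow hT.adjoint hR hS (h := T (S h) - R (T h)) (by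
    rw [ContinuousLinearMap.adjoint_adjoint, ← h1, ← map_sub, hT]) (m + 1)
  rw [← ContinuousLinearMap.adjoint_inner_right, h3.1, Function.iterate_succ_apply', he]

/-- The solution of `f = u + a S f`. -/
theorem exists_resolvent (hS : ∀ h, ‖S h‖ = ‖h‖) {a : ℂ} (ha : ‖a‖ < 1) (u : H) :
    ∃ f, f = u + a • S f ∧ HasSum (fun k : ℕ => a ^ k • S^[k] u) f := by
  have hSn : ∀ (k : ℕ) h, ‖S^[k] h‖ = ‖h‖ := by
    intro k h
    induction k with
    | zero => simp
    | succ k ih => rw [Function.iterate_succ_apply', hS, ih]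
  have hs : Summable (fun k : ℕ => a ^ k • S^[k] u) := by
    refine Summable.of_norm ?_
    simp only [norm_smul, norm_pow, hSn]
    exact (summable_geometric_of_lt_one (norm_nonneg _) ha).mul_right _
  refine ⟨_, ?_, hs.hasSum⟩
  rw [S.map_tsum hs, ← (S.summable hs).tsum_const_smul, hs.tsum_eq_zero_add]
  simp only [pow_zero, one_smul, Function.iterate_zero, id_eq, pow_succ', mul_smul,
    Function.iterate_succ_apply', map_smul]

/-- Pythagoras, since u ⟂ a S f and S is isometric. -/
theorem norm_sq_resolvent (hS : ∀ h, ‖S h‖ = ‖h‖) {a : ℂ} {u f : H}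
    (hf : f = u + a • S f) (hu : ⟪u, S f⟫_ℂ = 0) : (1 - ‖a‖ ^ 2) * ‖f‖ ^ 2 = ‖u‖ ^ 2 := by
  have h1 := norm_add_sq (𝕜 := ℂ) u (a • S f)
  rw [← hf, inner_smul_right, hu, norm_smul, hS] at h1
  simp at h1
  linarith

theorem inner_resolvent_eq_zero {a : ℂ} {u v f : H}
    (hf : HasSum (fun k : ℕ => a ^ k • S^[k] u) f)
    (hv : ∀ k, ⟪v, S^[k + 1] u⟫_ℂ = 0) : ⟪v, S f⟫_ℂ = 0 := by
  have h1 := ((innerSL ℂ v).comp S).hasSum hf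
  refine h1.unique ?_
  convert hasSum_zero with k
  have := hv k
  rw [Function.iterate_succ_apply'] at this
  rw [ContinuousLinearMap.comp_apply, map_smul, map_smul, innerSL_apply_apply, this, smul_zero]

/-- If `u` and `v` are wandering vectors for the isometry `S` and `v` is orthogonal to `S^k u` for
`k ≥ 1`, then the analytic function with coefficients `⟪S^k v, u⟫` is bounded by `‖u‖ ‖v‖`. -/
theorem norm_inner_resolvent_le (hS : ∀ h, ‖S h‖ = ‖h‖) {a : ℂ} (ha : ‖a‖ < 1) {u v g : H}
    (hu : ∀ k, ⟪u, S^[k + 1] u⟫_ℂ = 0) (hv : ∀ k, ⟪v, S^[k + 1] v⟫_ℂ = 0)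
    (hvu : ∀ k, ⟪v, S^[k + 1] u⟫_ℂ = 0) (hg : HasSum (fun k : ℕ => a ^ k • S^[k] v) g) :
    ‖⟪g, u⟫_ℂ‖ ≤ ‖u‖ * ‖v‖ := by
  obtain ⟨f, hf, hf'⟩ := exists_resolvent hS ha u
  obtain ⟨g', hg1, hg'⟩ := exists_resolvent hS ha v
  obtain rfl := hg'.unique hg
  have hin : ∀ x y, ⟪S x, S y⟫_ℂ = ⟪x, y⟫_ℂ :=
    (⟨S.toLinearMap, hS⟩ : H →ₗᵢ[ℂ] H).inner_map_map
  -- Expand f once, then g' once: v ⟂ S f leaves |a|² ⟪g', f⟫. Cauchy–Schwarz then loses nothing, as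
  -- the factor 1 − |a|² is absorbed by the norms of f and g'.
  have hgf : ⟪g', f⟫_ℂ * (1 - (‖a‖ : ℂ) ^ 2) = ⟪g', u⟫_ℂ := by
    have h1 : ⟪g', f⟫_ℂ = ⟪g', u⟫_ℂ + a * ⟪g', S f⟫_ℂ := by
      conv_lhs => rw [hf]
      rw [inner_add_right, inner_smul_right]
    have h2 : ⟪g', S f⟫_ℂ = conj a * ⟪g', f⟫_ℂ := by
      conv_lhs => rw [hg1]
      rw [inner_add_left, inner_smul_left, hin, inner_resolvent_eq_zero hf' hvu, zero_add]
    rw [h2, ← mul_assoc, RCLike.mul_conj] at h1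
    linear_combination h1
  have hpos : 0 < 1 - ‖a‖ ^ 2 := by nlinarith [norm_nonneg a]
  have e1 := norm_sq_resolvent hS hf (inner_resolvent_eq_zero hf' hu)
  have e2 := norm_sq_resolvent hS hg1 (inner_resolvent_eq_zero hg' hv)
  have h3 : ‖⟪g', u⟫_ℂ‖ ≤ (1 - ‖a‖ ^ 2) * (‖g'‖ * ‖f‖) := by
    rw [← hgf, norm_mul, mul_comm]
    have : ‖(1 - (‖a‖ : ℂ) ^ 2)‖ = 1 - ‖a‖ ^ 2 := by
      rw [← abs_of_pos hpos, ← Real.norm_eq_abs, ← Complex.norm_real]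
      push_cast
      rfl
    rw [this]
    exact mul_le_mul_of_nonneg_left (norm_inner_le_norm _ _) hpos.le
  refine h3.trans (le_of_eq ?_)
  rw [← pow_left_inj₀ (by positivity) (by positivity) two_ne_zero]
  calc ((1 - ‖a‖ ^ 2) * (‖g'‖ * ‖f‖)) ^ 2
      = ((1 - ‖a‖ ^ 2) * ‖f‖ ^ 2) * ((1 - ‖a‖ ^ 2) * ‖g'‖ ^ 2) := by ring
    _ = (‖u‖ * ‖v‖) ^ 2 := by rw [e1, e2]; ring

theorem norm_hasSum_inner_pow_le (hS : ∀ h, ‖S h‖ = ‖h‖) {w c : ℂ} (hw : ‖w‖ < 1) {u v : H}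
    (hu : ∀ k, ⟪u, S^[k + 1] u⟫_ℂ = 0) (hv : ∀ k, ⟪v, S^[k + 1] v⟫_ℂ = 0)
    (hvu : ∀ k, ⟪v, S^[k + 1] u⟫_ℂ = 0)
    (hc : HasSum (fun k : ℕ => w ^ k * ⟪S^[k] v, u⟫_ℂ) c) : ‖c‖ ≤ ‖u‖ * ‖v‖ := by
  -- The inner product is conjugate linear in its first argument, so the resolvent is taken at the
  -- conjugate of w.
  have hw' : ‖conj w‖ < 1 := by rwa [RCLike.norm_conj]
  obtain ⟨g, -, hg⟩ := exists_resolvent hS hw' v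
  have h1 : HasSum (fun k : ℕ => ⟪u, conj w ^ k • S^[k] v⟫_ℂ) ⟪u, g⟫_ℂ :=
    (innerSL ℂ u).hasSum hg
  have h2 : HasSum (fun k : ℕ => conj ⟪u, conj w ^ k • S^[k] v⟫_ℂ) (conj ⟪u, g⟫_ℂ) := h1.star
  simp only [inner_conj_symm, inner_smul_left, map_pow, RingHomCompTriple.comp_apply,
    RingHom.id_apply] at h2
  rw [hc.unique h2]
  exact norm_inner_resolvent_le hS hw' hu hv hvu hg

end Abstract

variable {E F : Type*} [NormedAddCommGroup E] [InnerProductSpace ℂ E] [CompleteSpace E]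
  [NormedAddCommGroup F] [InnerProductSpace ℂ F] [CompleteSpace F]

/-- Selects the inner product of `H²_E` as a subspace, rather than the one found through Hilbert
`C⋆`-modules. -/
instance innerH2 : Inner ℂ (H2 E) := InnerProductSpace.toInner

/-! ### Multiplication by `e^{int}` and constants in `L²` -/

theorem norm_fourier_apply (n : ℤ) (t : Torus) : ‖fourier n t‖ = 1 := by
  simpa only [fourier_apply] using Circle.norm_coe _

theorem conj_fourier_mul_self (n : ℤ) (t : Torus) : conj (fourier n t) * fourier n t = 1 := by
  rw [RCLike.conj_mul, norm_fourier_apply]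
  simp

/-- The symbol `e^{int} I`. -/
def fourierSymbol (E : Type*) [NormedAddCommGroup E] [InnerProductSpace ℂ E] (n : ℤ) :
    OpLInfty E E where
  toFun t := fourier n t • ContinuousLinearMap.id ℂ E
  meas x := ((fourier n).continuous.smul continuous_const).aestronglyMeasurable
  bdd := ⟨1, Eventually.of_forall fun t => by
    rw [norm_smul, norm_fourier_apply, one_mul]
    exact ContinuousLinearMap.norm_id_le⟩

/-- Multiplication by `e^{int}` on `L²_E`. -/
def mulFourier (n : ℤ) : L2 E →L[ℂ] L2 E := laurent (fourierSymbol E n)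

theorem coeFn_laurent (Φ : OpLInfty E F) (h : L2 E) :
    laurent Φ h =ᵐ[torusMeasure] fun t => Φ.toFun t (h t) :=
  (Φ.memLp_apply h).coeFn_toLp

theorem coeFn_mulFourier (n : ℤ) (h : L2 E) :
    mulFourier n h =ᵐ[torusMeasure] fun t => fourier n t • h t :=
  coeFn_laurent _ _

theorem inner_mulFourier_mulFourier (n : ℤ) (f g : L2 E) :
    ⟪mulFourier n f, mulFourier n g⟫_ℂ = ⟪f, g⟫_ℂ := by
  rw [L2.inner_def, L2.inner_def]
  refine integral_congr_ae ?_
  filter_upwards [coeFn_mulFourier n f, coeFn_mulFourier n g] with t h1 h2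
  rw [h1, h2, inner_smul_left, inner_smul_right, ← mul_assoc, conj_fourier_mul_self, one_mul]

theorem laurent_mulFourier (Φ : OpLInfty E F) (n : ℤ) (h : L2 E) :
    laurent Φ (mulFourier n h) = mulFourier n (laurent Φ h) := by
  refine Lp.ext ?_
  filter_upwards [coeFn_laurent Φ (mulFourier n h), coeFn_mulFourier n h,
    coeFn_mulFourier n (laurent Φ h), coeFn_laurent Φ h] with t h1 h2 h3 h4
  rw [h1, h2, h3, h4, map_smul]

theorem mulFourier_mulFourier (m n : ℤ) (h : L2 E) :
    mulFourier m (mulFourier n h) = mulFourier (m + n) h := by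
  refine Lp.ext ?_
  filter_upwards [coeFn_mulFourier m (mulFourier n h), coeFn_mulFourier n h,
    coeFn_mulFourier (m + n) h] with t h1 h2 h3
  rw [h1, h2, h3, fourier_add, mul_smul]

theorem mulFourier_zero (h : L2 E) : mulFourier 0 h = h := by
  refine Lp.ext ?_
  filter_upwards [coeFn_mulFourier 0 h] with t h1
  rw [h1, fourier_zero, one_smul]

theorem coeffL2_apply (n : ℤ) (f : L2 E) : coeffL2 E n f = fourierCoeff (f : Torus → E) n := rfl

theorem fourierCoeff_fourier_smul (f : Torus → E) (m n : ℤ) :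
    fourierCoeff (fun t => fourier n t • f t) m = fourierCoeff f (m - n) := by
  refine integral_congr_ae (Eventually.of_forall fun t => ?_)
  simp only [← mul_smul, ← fourier_add]
  congr 3
  ring

theorem coeffL2_mulFourier (m n : ℤ) (f : L2 E) :
    coeffL2 E m (mulFourier n f) = coeffL2 E (m - n) f := by
  rw [coeffL2_apply, fourierCoeff_congr_ae (coeFn_mulFourier n f), fourierCoeff_fourier_smul]
  rfl

/-- Constant functions in `L²_E`. -/
def constL2 (x : E) : L2 E := Lp.const 2 torusMeasure x

theorem coeFn_constL2 (x : E) : constL2 x =ᵐ[torusMeasure] fun _ => x := Lp.coeFn_const ..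

theorem fourierCoeff_const (x : E) (n : ℤ) :
    fourierCoeff (fun _ : Torus => x) n = if n = 0 then x else 0 := by
  have h := fourierCoeff_fourier (T := 2 * Real.pi) 0
  have h1 : fourierCoeff (fun _ : Torus => (1 : ℂ)) n = if n = 0 then 1 else 0 := by
    have h2 : (fun _ : Torus => (1 : ℂ)) = fourier 0 := by
      funext t
      rw [fourier_zero]
    rw [h2, h]
    simp [Pi.single_apply]
  have h3 : fourierCoeff (fun _ : Torus => x) n
      = fourierCoeff (fun _ : Torus => (1 : ℂ)) n • x := by
    rw [fourierCoeff, fourierCoeff, ← integral_smul_const]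
    simp
  rw [h3, h1]
  split_ifs <;> simp

theorem coeffL2_constL2 (x : E) (n : ℤ) : coeffL2 E n (constL2 x) = if n = 0 then x else 0 := by
  rw [coeffL2_apply, fourierCoeff_congr_ae (coeFn_constL2 x), fourierCoeff_const]

theorem inner_fourierCoeff {f : Torus → E} (hf : Integrable f torusMeasure) (x : E) (n : ℤ) :
    ⟪x, fourierCoeff f n⟫_ℂ = fourierCoeff (fun t => ⟪x, f t⟫_ℂ) n := by
  rw [fourierCoeff, fourierCoeff]
  have h := (innerSL ℂ x).integral_comp_comm (hf.fourier_smul (-n))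
  simpa only [innerSL_apply_apply, inner_smul_right, smul_eq_mul] using h.symm

theorem inner_mulFourier_constL2 (n : ℤ) (x : E) (f : L2 E) :
    ⟪mulFourier n (constL2 x), f⟫_ℂ = ⟪x, coeffL2 E n f⟫_ℂ := by
  rw [coeffL2_apply, inner_fourierCoeff (integrable_of_L2 f), L2.inner_def, fourierCoeff]
  refine integral_congr_ae ?_
  filter_upwards [coeFn_mulFourier n (constL2 x), coeFn_constL2 x] with t h1 h2
  rw [h1, h2, inner_smul_left, fourier_neg, smul_eq_mul]

theorem coeffL2_laurent_constL2 (Φ : OpLInfty E F) (x : E) (n : ℤ) :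
    coeffL2 F n (laurent Φ (constL2 x)) = Φ.coeff n x := by
  have h : laurent Φ (constL2 x) =ᵐ[torusMeasure] fun t => Φ.toFun t x := by
    filter_upwards [coeFn_laurent Φ (constL2 x), coeFn_constL2 x] with t h1 h2
    rw [h1, h2]
  rw [coeffL2_apply, fourierCoeff_congr_ae h]
  rfl

/-! ### Uniqueness of Fourier coefficients -/

theorem ae_eq_of_fourierCoeff_eq {f g : Torus → ℂ} (hf : MemLp f 2 torusMeasure)
    (hg : MemLp g 2 torusMeasure) (h : ∀ n, fourierCoeff f n = fourierCoeff g n) :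
    f =ᵐ[torusMeasure] g := by
  rw [← hf.toLp_eq_toLp_iff hg]
  refine (fourierBasis (T := 2 * Real.pi)).repr.injective ?_
  ext n
  rw [fourierBasis_repr, fourierBasis_repr, fourierCoeff_congr_ae hf.coeFn_toLp,
    fourierCoeff_congr_ae hg.coeFn_toLp, h]

/-- Testing against each fixed vector reduces this to scalar functions; separability lets countably
many vectors decide. -/
theorem L2.ext_coeff [TopologicalSpace.SeparableSpace E] {f g : L2 E}
    (h : ∀ n, coeffL2 E n f = coeffL2 E n g) : f = g := by
  have : SecondCountableTopology E := UniformSpace.secondCountable_of_separable E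
  refine Lp.ext ?_
  have h0 : (fun t => f t - g t) =ᵐ[torusMeasure] 0 := by
    refine ae_eq_zero_of_forall_inner (𝕜 := ℂ) fun c => ?_
    have h1 := ae_eq_of_fourierCoeff_eq (f := fun t => ⟪c, f t⟫_ℂ) (g := fun t => ⟪c, g t⟫_ℂ)
      ((Lp.memLp f).const_inner c) ((Lp.memLp g).const_inner c) (fun n => by
        rw [← inner_fourierCoeff (integrable_of_L2 f), ← inner_fourierCoeff (integrable_of_L2 g)]
        exact congrArg _ (h n))
    filter_upwards [h1] with t ht
    rw [inner_sub_right, ht, sub_self, Pi.zero_apply]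
  filter_upwards [h0] with t ht
  exact sub_eq_zero.1 ht

/-! ### The shift on the Hardy space -/

/-- The shift `h ↦ e^{it} h` on `H²_E`. -/
def shift (E : Type*) [NormedAddCommGroup E] [InnerProductSpace ℂ E] [CompleteSpace E] :
    H2 E →L[ℂ] H2 E :=
  ((mulFourier 1).comp (H2 E).subtypeL).codRestrict (H2 E) fun h n hn => by
    rw [ContinuousLinearMap.comp_apply, coeffL2_mulFourier]
    exact h.2 _ (by omega)

theorem coe_shift (h : H2 E) : (shift E h : L2 E) = mulFourier 1 (h : L2 E) := rfl

theorem coe_shift_pow (n : ℕ) (h : H2 E) :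
    ((shift E)^[n] h : L2 E) = mulFourier n (h : L2 E) := by
  induction n with
  | zero => simp [mulFourier_zero]
  | succ n ih =>
    rw [Function.iterate_succ_apply', coe_shift, ih, mulFourier_mulFourier]
    push_cast
    rw [add_comm]

theorem norm_shift (h : H2 E) : ‖shift E h‖ = ‖h‖ := by
  rw [Submodule.coe_norm, Submodule.coe_norm, coe_shift, @norm_eq_sqrt_re_inner ℂ,
    inner_mulFourier_mulFourier, ← @norm_eq_sqrt_re_inner ℂ]

/-- Constant functions in `H²_E`. -/
def constH2 (x : E) : H2 E := ⟨constL2 x, fun n hn => by rw [coeffL2_constL2, if_neg hn.ne]⟩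

/-- The isometric embedding of `E` into `H²_E` as constant functions. -/
def constH2L (E : Type*) [NormedAddCommGroup E] [InnerProductSpace ℂ E] [CompleteSpace E] :
    E →L[ℂ] H2 E :=
  ((Lp.constL 2 torusMeasure ℂ).codRestrict (H2 E) fun x => (constH2 x).2)

theorem coe_constH2 (x : E) : (constH2 x : L2 E) = constL2 x := rfl

/-- Shifted constants read off Fourier coefficients: this translates the abstract lemmas into
statements on symbols. -/
theorem inner_shift_pow_constH2 (n : ℕ) (x : E) (f : H2 E) :
    ⟪(shift E)^[n] (constH2 x), f⟫_ℂ = ⟪x, coeffL2 E n (f : L2 E)⟫_ℂ := by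
  rw [Submodule.coe_inner, coe_shift_pow, coe_constH2, inner_mulFourier_constL2]

theorem inner_constH2 (x : E) (f : H2 E) :
    ⟪constH2 x, f⟫_ℂ = ⟪x, coeffL2 E 0 (f : L2 E)⟫_ℂ := by
  simpa using inner_shift_pow_constH2 0 x f

theorem norm_constH2 (x : E) : ‖constH2 x‖ = ‖x‖ := by
  rw [@norm_eq_sqrt_re_inner ℂ, inner_constH2, coe_constH2, coeffL2_constL2, if_pos rfl,
    ← @norm_eq_sqrt_re_inner ℂ]

/-- Constants thus serve as the vectors e of the abstract lemmas. -/
theorem inner_constH2_shift (x : E) (f : H2 E) : ⟪constH2 x, shift E f⟫_ℂ = 0 := by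
  rw [inner_constH2, coe_shift, coeffL2_mulFourier, f.2 _ (by norm_num), inner_zero_right]

/-! ### Toeplitz operators and the shift -/

theorem inner_toeplitz (Φ : OpLInfty E F) (k : H2 F) (h : H2 E) :
    ⟪k, toeplitz Φ h⟫_ℂ = ⟪(k : L2 F), laurent Φ (h : L2 E)⟫_ℂ := by
  rw [Submodule.coe_inner]
  exact Submodule.inner_orthogonalProjectionOnto_eq_of_mem_left k _

theorem isToeplitzFor_toeplitz (Φ : OpLInfty E F) :
    IsToeplitzFor (shift E) (shift F) (toeplitz Φ) := by
  intro k h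
  rw [inner_toeplitz, inner_toeplitz, coe_shift, coe_shift, laurent_mulFourier,
    inner_mulFourier_mulFourier]

theorem coeffL2_toeplitz_shift_pow (Φ : OpLInfty E F) (m n : ℕ) (x : E) :
    coeffL2 F m (toeplitz Φ ((shift E)^[n] (constH2 x)) : L2 F) = Φ.coeff (m - n) x := by
  refine ext_inner_left ℂ fun y => ?_
  rw [← inner_shift_pow_constH2, inner_toeplitz, coe_shift_pow, coe_shift_pow, coe_constH2,
    coe_constH2, laurent_mulFourier, inner_mulFourier_constL2, coeffL2_mulFourier,
    coeffL2_laurent_constL2]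

theorem coeffL2_toeplitz_constH2 (Φ : OpLInfty E F) (m : ℕ) (x : E) :
    coeffL2 F m (toeplitz Φ (constH2 x) : L2 F) = Φ.coeff m x := by
  simpa using coeffL2_toeplitz_shift_pow Φ m 0 x

theorem coeffL2_adjoint_toeplitz_constH2 (Φ : OpLInfty E F) (n : ℕ) (y : F) :
    coeffL2 E n (((toeplitz Φ)†) (constH2 y) : L2 E) = ((Φ.coeff (-(n : ℤ)))†) y := by
  refine ext_inner_left ℂ fun x => ?_
  rw [← inner_shift_pow_constH2, ContinuousLinearMap.adjoint_inner_right,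
    ContinuousLinearMap.adjoint_inner_right, ← inner_conj_symm, inner_constH2]
  have h := coeffL2_toeplitz_shift_pow Φ 0 n x
  simp only [Nat.cast_zero, zero_sub] at h
  rw [h, inner_conj_symm]

theorem coeffL2_zero_adjoint_toeplitz_shift_pow (Φ : OpLInfty E F) (n : ℕ) (y : F) :
    coeffL2 E 0 (((toeplitz Φ)†) ((shift F)^[n] (constH2 y)) : L2 E) = ((Φ.coeff n)†) y := by
  refine ext_inner_left ℂ fun x => ?_
  rw [← inner_constH2, ContinuousLinearMap.adjoint_inner_right,
    ContinuousLinearMap.adjoint_inner_right, ← inner_conj_symm, inner_shift_pow_constH2,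
    coeffL2_toeplitz_constH2, inner_conj_symm]

/-- For an operator `X` of Toeplitz type, the range of `X S - S X` consists of constants. -/
theorem IsToeplitzFor.apply_shift_sub_shift_apply [TopologicalSpace.SeparableSpace F]
    {X : H2 E →L[ℂ] H2 F} (hX : IsToeplitzFor (shift E) (shift F) X) (h : H2 E) :
    X (shift E h) - shift F (X h) = constH2 (coeffL2 F 0 (X (shift E h) : L2 F)) := by
  refine Subtype.ext (L2.ext_coeff fun j => ?_)
  rw [coe_constH2, coeffL2_constL2, Submodule.coe_sub, map_sub, coe_shift (X h),
    coeffL2_mulFourier]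
  rcases lt_trichotomy j 0 with hj | rfl | hj
  · rw [if_neg hj.ne, (X _).2 j hj, (X _).2 (j - 1) (by omega), sub_zero]
  · rw [(X h).2 _ (by norm_num), sub_zero, if_pos rfl]
  -- For j > 0 the Toeplitz relation identifies coefficient j of X S h with coefficient j − 1 of X
  -- h.
  · obtain ⟨k, rfl⟩ : ∃ k : ℕ, j = (k + 1 : ℕ) := ⟨(j - 1).toNat, by omega⟩
    rw [if_neg hj.ne', show ((k + 1 : ℕ) : ℤ) - 1 = k by push_cast; ring, sub_eq_zero]
    refine ext_inner_left ℂ fun y => ?_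
    rw [← inner_shift_pow_constH2, ← inner_shift_pow_constH2, Function.iterate_succ_apply', hX]

/-- A wandering vector `u` of the shift, as a function on the disc, is bounded by `‖u‖`. -/
theorem norm_tsum_coeffL2_le {u : H2 E} (hu : ∀ k, ⟪u, (shift E)^[k + 1] u⟫_ℂ = 0) {w : ℂ}
    (hw : ‖w‖ < 1) {v : E} (hv : HasSum (fun m : ℕ => w ^ m • coeffL2 E m (u : L2 E)) v) :
    ‖v‖ ≤ ‖u‖ := by
  have hconst : ∀ (f : H2 E) (k : ℕ), ⟪constH2 v, (shift E)^[k + 1] f⟫_ℂ = 0 := fun f k => by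
    rw [Function.iterate_succ_apply', inner_constH2_shift]
  have hc : HasSum (fun k : ℕ => w ^ k * ⟪(shift E)^[k] (constH2 v), u⟫_ℂ) ⟪v, v⟫_ℂ := by
    have h1 : HasSum (fun m : ℕ => ⟪v, w ^ m • coeffL2 E m (u : L2 E)⟫_ℂ) ⟪v, v⟫_ℂ :=
      (innerSL ℂ v).hasSum hv
    simpa only [inner_shift_pow_constH2, inner_smul_right] using h1
  -- The second wandering vector is the constant v, the value being estimated; the bound reads ‖v‖²
  -- ≤ ‖u‖ ‖v‖.
  have h1 := norm_hasSum_inner_pow_le (S := shift E) norm_shift hw hu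
    (hconst (constH2 v)) (hconst u) hc
  rw [inner_self_eq_norm_sq_to_K, norm_constH2] at h1
  simp only [norm_pow, RCLike.norm_ofReal, abs_norm] at h1
  exact le_of_sq_le_mul (norm_nonneg _) h1

/-! ### Power series and boundary functions -/

theorem MemHInfty.exists_hasSum {Θ : ℂ → E →L[ℂ] F} (hΘ : MemHInfty Θ) :
    ∃ c : ℕ → E →L[ℂ] F, ∀ z : ℂ, ‖z‖ < 1 → HasSum (fun m => z ^ m • c m) (Θ z) := by
  refine ⟨fun m => ((Nat.factorial m : ℕ) : ℂ)⁻¹ • iteratedDeriv m Θ 0, fun z hz => ?_⟩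
  have h := Complex.hasSum_taylorSeries_on_ball hΘ.1 (z := z) (by simpa using hz)
  refine h.congr_fun fun m => ?_
  rw [sub_zero, smul_comm]

/-- Comparison with (r/s)^m for some s in (r, 1). It justifies the termwise integration in
`fourierCoeff_dilate`. -/
theorem summable_norm_of_summable_pow {V : Type*} [NormedAddCommGroup V] [NormedSpace ℂ V]
    {c : ℕ → V} (h : ∀ z : ℂ, ‖z‖ < 1 → Summable (fun m => z ^ m • c m)) {r : ℝ} (hr0 : 0 ≤ r)
    (hr : r < 1) : Summable (fun m => r ^ m * ‖c m‖) := by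
  obtain ⟨s, hrs, hs⟩ := exists_between hr
  have hs0 : 0 < s := hr0.trans_lt hrs
  have h1 := (h s (by rwa [Complex.norm_real, Real.norm_of_nonneg hs0.le])).tendsto_atTop_zero
  have h2 : ∀ᶠ m in atTop, ‖(s : ℂ) ^ m • c m‖ ≤ 1 := by
    have := h1.norm
    rw [norm_zero] at this
    exact this.eventually_le_const one_pos
  refine Summable.of_norm_bounded_eventually_nat (g := fun m => (r / s) ^ m)
    (summable_geometric_of_lt_one (by positivity) ((div_lt_one hs0).2 hrs)) ?_
  filter_upwards [h2] with m hm
  rw [norm_smul, norm_pow, Complex.norm_real, Real.norm_of_nonneg hs0.le] at hm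
  rw [Real.norm_of_nonneg (by positivity), div_pow, le_div_iff₀ (by positivity)]
  calc r ^ m * ‖c m‖ * s ^ m = r ^ m * (s ^ m * ‖c m‖) := by ring
    _ ≤ r ^ m * 1 := by gcongr
    _ = r ^ m := mul_one _

theorem hasSum_clm_apply {f : ℕ → E →L[ℂ] F} {A : E →L[ℂ] F} (h : HasSum f A) (x : E) :
    HasSum (fun m => f m x) (A x) :=
  h.mapL (ContinuousLinearMap.apply ℂ F x)

theorem norm_mul_fourier (r : ℝ) (t : Torus) : ‖(r : ℂ) * fourier 1 t‖ = |r| := by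
  rw [norm_mul, norm_fourier_apply, mul_one, Complex.norm_real, Real.norm_eq_abs]

theorem eventually_mem_Ioo : ∀ᶠ r : ℝ in 𝓝[<] 1, r ∈ Set.Ioo 0 1 :=
  Ioo_mem_nhdsLT one_pos

/-- The Fourier coefficients of `t ↦ Θ(r e^{it}) x`. -/
theorem fourierCoeff_dilate {Θ : ℂ → E →L[ℂ] F} {c : ℕ → E →L[ℂ] F}
    (hc : ∀ z : ℂ, ‖z‖ < 1 → HasSum (fun m => z ^ m • c m) (Θ z)) {r : ℝ}
    (hr : r ∈ Set.Ioo 0 1) (x : E) (n : ℤ) :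
    fourierCoeff (fun t : Torus => Θ ((r : ℂ) * fourier 1 t) x) n =
      (r : ℂ) ^ n.toNat • if 0 ≤ n then c n.toNat x else 0 := by
  set f : ℕ → Torus → F := fun m t => fourier (-n) t • ((r : ℂ) * fourier 1 t) ^ m • c m x with hf
  have hfm : ∀ m t, f m t = (r : ℂ) ^ m • (fourier (-(n - m)) t • c m x) := by
    intro m t
    simp only [hf, mul_pow]
    have h1 : (fourier 1 t : ℂ) ^ m = fourier (m : ℤ) t := by
      induction m with
      | zero => simp
      | succ m ih => rw [pow_succ, ih, Nat.cast_succ, fourier_add]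
    rw [h1, show -(n - m : ℤ) = -n + m by ring, fourier_add, smul_smul, smul_smul]
    congr 1
    ring
  have hnorm : ∀ m t, ‖f m t‖ = r ^ m * ‖c m x‖ := by
    intro m t
    rw [hfm, norm_smul, norm_smul, norm_fourier_apply, one_mul, norm_pow, Complex.norm_real,
      Real.norm_of_nonneg hr.1.le]
  have hint : ∀ m, ∫ t, f m t ∂torusMeasure =
      (r : ℂ) ^ m • if n - m = 0 then c m x else 0 := by
    intro m
    simp only [hfm]
    rw [integral_smul, ← fourierCoeff_const]
    rfl
  have hsum : Summable (fun m => r ^ m * ‖c m x‖) := by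
    refine summable_norm_of_summable_pow (c := fun m => c m x) (fun z hz => ?_) hr.1.le hr.2
    exact (hasSum_clm_apply (hc z hz) x).summable
  have h := hasSum_integral_of_summable_integral_norm (μ := torusMeasure) (F := f)
    (fun m => by
      refine Continuous.integrable_of_hasCompactSupport ?_ (HasCompactSupport.of_compactSpace _)
      simp only [hf]
      fun_prop)
    (by simpa only [hnorm, integral_const, probReal_univ, one_smul] using hsum)
  have h1 : ∫ t, ∑' m, f m t ∂torusMeasure =
      fourierCoeff (fun t : Torus => Θ ((r : ℂ) * fourier 1 t) x) n := by
    refine integral_congr_ae (Eventually.of_forall fun t => ?_)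
    have hz : ‖(r : ℂ) * fourier 1 t‖ < 1 := by
      rw [norm_mul_fourier, abs_of_pos hr.1]
      exact hr.2
    have h2 : HasSum (fun m => ((r : ℂ) * fourier 1 t) ^ m • c m x)
        (Θ ((r : ℂ) * fourier 1 t) x) := hasSum_clm_apply (hc _ hz) x
    have h3 : HasSum (fun m => f m t) (fourier (-n) t • Θ ((r : ℂ) * fourier 1 t) x) :=
      h2.const_smul (fourier (-n) t : ℂ)
    exact h3.tsum_eq
  rw [h1] at h
  refine h.unique ?_
  simp only [hint]
  -- If n < 0, then `n.toNat` is 0 and every term vanishes.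
  convert hasSum_single n.toNat ?_ using 1
  · congr 1
    by_cases hn : 0 ≤ n
    · rw [if_pos hn, if_pos (by omega)]
    · rw [if_neg hn, if_neg (by omega)]
  · intro m hm
    rw [if_neg (by omega), smul_zero]

theorem continuous_dilate {Θ : ℂ → E →L[ℂ] F} (hΘ : MemHInfty Θ) {r : ℝ} (hr : r ∈ Set.Ioo 0 1)
    (x : E) : Continuous (fun t : Torus => Θ ((r : ℂ) * fourier 1 t) x) := by
  have h1 : Continuous (fun t : Torus => Θ ((r : ℂ) * fourier 1 t)) := by
    refine hΘ.1.continuousOn.comp_continuous (by fun_prop) fun t => ?_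
    rw [mem_ball_zero_iff, norm_mul_fourier, abs_of_pos hr.1]
    exact hr.2
  exact h1.clm_apply continuous_const

theorem norm_dilate_le {Θ : ℂ → E →L[ℂ] F} {C : ℝ}
    (hC : ∀ z ∈ Metric.ball (0 : ℂ) 1, ‖Θ z‖ ≤ C) {r : ℝ} (hr : r ∈ Set.Ioo 0 1) (x : E)
    (t : Torus) : ‖Θ ((r : ℂ) * fourier 1 t) x‖ ≤ C * ‖x‖ := by
  refine ContinuousLinearMap.le_of_opNorm_le _ (hC _ ?_) x
  rw [mem_ball_zero_iff, norm_mul_fourier, abs_of_pos hr.1]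
  exact hr.2

/-- The boundary function of an `H^∞` function, as an element of `L^∞`. -/
def IsBoundaryFunction.symbol {Θ : ℂ → E →L[ℂ] F} {θ : Torus → E →L[ℂ] F}
    (hθ : IsBoundaryFunction Θ θ) (hΘ : MemHInfty Θ) : OpLInfty E F where
  toFun := θ
  meas x := by
    obtain ⟨u, -, hu1, hu⟩ := exists_seq_strictMono_tendsto' (x := (1 : ℝ)) one_pos
    have hu' : Tendsto u atTop (𝓝[<] 1) :=
      tendsto_nhdsWithin_iff.2 ⟨hu, Eventually.of_forall fun n => (hu1 n).2⟩
    refine aestronglyMeasurable_of_tendsto_ae atTop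
      (f := fun n t => Θ ((u n : ℂ) * fourier 1 t) x)
      (fun n => (continuous_dilate hΘ (hu1 n) x).aestronglyMeasurable) ?_
    filter_upwards [hθ] with t ht
    exact (ht x).comp hu'
  bdd := by
    obtain ⟨-, C, hC⟩ := hΘ
    have hC0 : 0 ≤ C := (norm_nonneg _).trans (hC 0 (by simp))
    refine ⟨C, ?_⟩
    filter_upwards [hθ] with t ht
    refine ContinuousLinearMap.opNorm_le_bound _ hC0 fun x => ?_
    refine le_of_tendsto (ht x).norm ?_
    filter_upwards [eventually_mem_Ioo] with r hr
    exact norm_dilate_le hC hr x t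

/-- Dominated convergence as r → 1 in the coefficients of the dilates. -/
theorem IsBoundaryFunction.coeff_symbol {Θ : ℂ → E →L[ℂ] F} {θ : Torus → E →L[ℂ] F}
    (hθ : IsBoundaryFunction Θ θ) (hΘ : MemHInfty Θ) {c : ℕ → E →L[ℂ] F}
    (hc : ∀ z : ℂ, ‖z‖ < 1 → HasSum (fun m => z ^ m • c m) (Θ z)) (n : ℤ) :
    (hθ.symbol hΘ).coeff n = if 0 ≤ n then c n.toNat else 0 := by
  ext x
  obtain ⟨C, hC⟩ := hΘ.2
  have h1 : Tendsto (fun r : ℝ => fourierCoeff (fun t : Torus => Θ ((r : ℂ) * fourier 1 t) x) n)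
      (𝓝[<] 1) (𝓝 (fourierCoeff (fun t => θ t x) n)) := by
    refine tendsto_integral_filter_of_dominated_convergence (fun _ => C * ‖x‖) ?_ ?_
      (integrable_const _) ?_
    · filter_upwards [eventually_mem_Ioo] with r hr
      exact ((map_continuous _).smul (continuous_dilate hΘ hr x)).aestronglyMeasurable
    · filter_upwards [eventually_mem_Ioo] with r hr
      refine Eventually.of_forall fun t => ?_
      rw [norm_smul, norm_fourier_apply, one_mul]
      exact norm_dilate_le hC hr x t
    · filter_upwards [hθ] with t ht
      exact (ht x).const_smul _
  have h2 : Tendsto (fun r : ℝ => (r : ℂ) ^ n.toNat • if 0 ≤ n then c n.toNat x else 0)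
      (𝓝[<] 1) (𝓝 ((1 : ℂ) ^ n.toNat • if 0 ≤ n then c n.toNat x else 0)) := by
    refine Tendsto.smul_const (Tendsto.pow ?_ _) _
    exact (Complex.continuous_ofReal.tendsto' 1 1 (by simp)).mono_left nhdsWithin_le_nhds
  rw [one_pow, one_smul] at h2
  have h3 : fourierCoeff (fun t => θ t x) n = if 0 ≤ n then c n.toNat x else 0 := by
    refine tendsto_nhds_unique h1 (h2.congr' ?_)
    filter_upwards [eventually_mem_Ioo] with r hr
    rw [fourierCoeff_dilate hc hr]
  refine Eq.trans h3 ?_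
  split_ifs <;> rfl

/-! ### Reflection `t ↦ -t` -/

theorem fourier_one_neg (t : Torus) : (fourier 1 (-t) : ℂ) = conj (fourier 1 t) := by
  rw [← fourier_neg, fourier_apply, fourier_apply]
  simp

theorem ae_neg {p : Torus → Prop} (h : ∀ᵐ t ∂torusMeasure, p t) : ∀ᵐ t ∂torusMeasure, p (-t) :=
  (Measure.measurePreserving_neg torusMeasure).quasiMeasurePreserving.ae h

theorem IsBoundaryFunction.reflect {Θ : ℂ → E →L[ℂ] F} {θ : Torus → E →L[ℂ] F}
    (hθ : IsBoundaryFunction Θ θ) : IsBoundaryFunction (fun z => Θ (conj z)) (fun t => θ (-t)) := by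
  filter_upwards [ae_neg hθ] with t ht x
  refine (ht x).congr fun r => ?_
  rw [fourier_one_neg, map_mul, Complex.conj_ofReal]

/-- The symbol `t ↦ Φ(-t)`. -/
def OpLInfty.reflect (Φ : OpLInfty E F) : OpLInfty E F where
  toFun t := Φ.toFun (-t)
  meas x := by
    have h : MeasurePreserving (fun t : Torus => -t) torusMeasure torusMeasure :=
      Measure.measurePreserving_neg torusMeasure
    have h1 := Φ.meas x
    exact h1.comp_quasiMeasurePreserving h.quasiMeasurePreserving
  bdd := by
    obtain ⟨C, hC⟩ := Φ.bdd
    exact ⟨C, ae_neg (p := fun t => ‖Φ.toFun t‖ ≤ C) hC⟩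

theorem OpLInfty.coeff_reflect (Φ : OpLInfty E F) (n : ℤ) :
    Φ.reflect.coeff n = Φ.coeff (-n) := by
  ext x
  have h := integral_neg_eq_self (fun t : Torus => fourier (-(-n)) t • Φ.toFun t x) torusMeasure
  refine Eq.trans (integral_congr_ae (Eventually.of_forall fun t => ?_)) h
  simp only [fourier_apply, neg_neg, neg_smul, smul_neg]
  rfl

/-- Reflection exchanges the two parts of the symbol, so boundary results for Φ_- follow from those
for Φ_+. -/
theorem OpLInfty.plus_reflect (Φ : OpLInfty E F) (z : ℂ) : Φ.reflect.plus (conj z) = Φ.minus z := by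
  simp only [OpLInfty.plus, OpLInfty.minus, coeff_reflect]

theorem OpLInfty.MemHInftyAddConj.reflect {Φ : OpLInfty E F} (hΦ : Φ.MemHInftyAddConj) :
    Φ.reflect.MemHInftyAddConj := by
  obtain ⟨Θ, Ψ, hΘ, hΨ, θ, ψ, hθ, hψ, h⟩ := hΦ
  refine ⟨Ψ, Θ, hΨ, hΘ, fun t => ψ (-t), fun t => θ (-t), ?_, hθ.reflect, ?_⟩
  · simpa only [Complex.conj_conj] using hψ.reflect
  · filter_upwards [ae_neg h] with t ht
    rw [add_comm]
    exact ht

/-! ### Boundary values of the analytic and co-analytic parts -/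

theorem OpLInfty.coeff_eq_add {Φ Φ₁ Φ₂ : OpLInfty E F}
    (h : ∀ᵐ t ∂torusMeasure, Φ.toFun t = Φ₁.toFun t + Φ₂.toFun t) (n : ℤ) :
    Φ.coeff n = Φ₁.coeff n + Φ₂.coeff n := by
  ext x
  have h1 : (fun t => Φ.toFun t x) =ᵐ[torusMeasure]
      (fun t => Φ₁.toFun t x) + fun t => Φ₂.toFun t x := by
    filter_upwards [h] with t ht
    rw [ht]
    rfl
  exact (congrFun (fourierCoeff_congr_ae h1) n).trans
    (congrFun (fourierCoeff.add (Φ₁.integrable_apply x) (Φ₂.integrable_apply x)) n)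

/-- The constant symbol. -/
def OpLInfty.const (A : E →L[ℂ] F) : OpLInfty E F where
  toFun _ := A
  meas _ := aestronglyMeasurable_const
  bdd := ⟨‖A‖, Eventually.of_forall fun _ => le_rfl⟩

theorem OpLInfty.coeff_const (A : E →L[ℂ] F) (n : ℤ) :
    (OpLInfty.const A).coeff n = if n = 0 then A else 0 := by
  ext x
  refine Eq.trans (fourierCoeff_const (A x) n) ?_
  split_ifs <;> rfl

/-- On the disc Φ_+ is Θ plus the constant term d 0 of Ψ, so it inherits the radial limits of Θ. -/
theorem OpLInfty.MemHInftyAddConj.exists_boundary_plus {Φ : OpLInfty E F}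
    (hΦ : Φ.MemHInftyAddConj) : ∃ φ : OpLInfty E F, IsBoundaryFunction Φ.plus φ.toFun ∧
      ∀ n, φ.coeff n = if 0 ≤ n then Φ.coeff n else 0 := by
  obtain ⟨Θ, Ψ, hΘ, hΨ, θ, ψ, hθ, hψ, h⟩ := hΦ
  obtain ⟨c, hc⟩ := hΘ.exists_hasSum
  obtain ⟨d, hd⟩ := hΨ.exists_hasSum
  have hψ' : IsBoundaryFunction Ψ (fun t => ψ (-t)) := by
    simpa only [Complex.conj_conj] using hψ.reflect
  have hcoeff : ∀ n : ℤ, Φ.coeff n =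
      (if 0 ≤ n then c n.toNat else 0) + if 0 ≤ -n then d (-n).toNat else 0 := by
    intro n
    rw [OpLInfty.coeff_eq_add (Φ₁ := hθ.symbol hΘ) (Φ₂ := (hψ'.symbol hΨ).reflect) ?_ n,
      OpLInfty.coeff_reflect, hθ.coeff_symbol hΘ hc, hψ'.coeff_symbol hΨ hd]
    filter_upwards [h] with t ht
    rw [ht]
    simp [IsBoundaryFunction.symbol, OpLInfty.reflect]
  have hcoeffN : ∀ m : ℕ, Φ.coeff m = c m + if m = 0 then d 0 else 0 := by
    intro m
    rw [hcoeff]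
    rcases Nat.eq_zero_or_pos m with rfl | hm
    · simp
    · rw [if_neg (by omega : ¬ (0 : ℤ) ≤ -(m : ℤ)), if_neg hm.ne']
      simp
  have hplus : ∀ z : ℂ, ‖z‖ < 1 → Φ.plus z = Θ z + d 0 := by
    intro z hz
    have h1 : HasSum (fun m : ℕ => z ^ m • if m = 0 then d 0 else 0) (d 0) := by
      convert hasSum_single 0 ?_ using 1
      · simp
      · intro m hm
        simp [hm]
    refine HasSum.tsum_eq (((hc z hz).add h1).congr_fun fun m => ?_)
    rw [hcoeffN, smul_add]
  refine ⟨⟨fun t => θ t + d 0, fun x => ((hθ.symbol hΘ).meas x).add aestronglyMeasurable_const,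
    ?_⟩, ?_, fun n => ?_⟩
  · obtain ⟨C, hC⟩ := (hθ.symbol hΘ).bdd
    refine ⟨C + ‖d 0‖, ?_⟩
    filter_upwards [hC] with t ht
    exact (norm_add_le _ _).trans (add_le_add_left ht _)
  · filter_upwards [hθ] with t ht x
    refine ((ht x).add_const (d 0 x)).congr' ?_
    filter_upwards [eventually_mem_Ioo] with r hr
    rw [hplus]
    · rfl
    · rw [norm_mul_fourier, abs_of_pos hr.1]
      exact hr.2
  · rw [OpLInfty.coeff_eq_add (Φ₁ := hθ.symbol hΘ) (Φ₂ := OpLInfty.const (d 0))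
      (Eventually.of_forall fun t => rfl), OpLInfty.coeff_const, hθ.coeff_symbol hΘ hc]
    by_cases hn : 0 ≤ n
    · lift n to ℕ using hn
      rw [hcoeffN]
      simp
    · rw [if_neg hn, if_neg hn, if_neg (by omega), add_zero]

theorem OpLInfty.MemHInftyAddConj.exists_boundary_minus {Φ : OpLInfty E F}
    (hΦ : Φ.MemHInftyAddConj) : ∃ φ : OpLInfty E F, IsBoundaryFunction Φ.minus φ.toFun ∧
      ∀ n, φ.coeff n = if n ≤ 0 then Φ.coeff n else 0 := by
  obtain ⟨φ, hφ, hc⟩ := hΦ.reflect.exists_boundary_plus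
  refine ⟨φ.reflect, ?_, fun n => ?_⟩
  · have h := hφ.reflect
    simp only [OpLInfty.plus_reflect] at h
    exact h
  · rw [OpLInfty.coeff_reflect, hc, OpLInfty.coeff_reflect, neg_neg]
    simp only [Left.nonneg_neg_iff]

/-! ### Contractivity -/

theorem norm_coeffL2_le (f : L2 E) (n : ℤ) : ‖coeffL2 E n f‖ ≤ ‖f‖ :=
  norm_integral_fourier_smul_le f n

theorem summable_pow_mul_norm {c : ℕ → E →L[ℂ] F} (hc : ∀ m, ‖c m‖ ≤ 1) {r : ℝ} (hr0 : 0 ≤ r)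
    (hr : r < 1) : Summable (fun m => r ^ m * ‖c m‖) :=
  Summable.of_nonneg_of_le (fun m => by positivity)
    (fun m => mul_le_of_le_one_right (by positivity) (hc m))
    (summable_geometric_of_lt_one hr0 hr)

theorem differentiableOn_tsum_pow_smul {c : ℕ → E →L[ℂ] F} (hc : ∀ m, ‖c m‖ ≤ 1) :
    DifferentiableOn ℂ (fun z : ℂ => ∑' m, z ^ m • c m) (Metric.ball 0 1) := by
  intro z hz
  rw [mem_ball_zero_iff] at hz
  obtain ⟨r, hzr, hr⟩ := exists_between hz
  have h : DifferentiableOn ℂ (fun z : ℂ => ∑' m, z ^ m • c m) (Metric.ball 0 r) := by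
    refine Complex.differentiableOn_tsum_of_summable_norm
      (summable_pow_mul_norm hc ((norm_nonneg z).trans hzr.le) hr)
      (fun m => ((differentiable_id.pow m).smul_const (c m)).differentiableOn) Metric.isOpen_ball
      fun m w hw => ?_
    rw [mem_ball_zero_iff] at hw
    rw [norm_smul, norm_pow]
    gcongr
  exact (h.differentiableAt (Metric.isOpen_ball.mem_nhds (by simpa using hzr))).differentiableWithinAt

/-- Stated for a general X so as to apply to both T and T†. Analyticity needs only ‖c m‖ ≤ 1;
contractivity comes from the wandering property. -/
theorem isContractiveAnalytic_tsum {X : H2 E →L[ℂ] H2 F} (hX : ∀ h, ‖X h‖ ≤ ‖h‖)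
    (hw : ∀ x x' k, ⟪X (constH2 x), (shift F)^[k + 1] (X (constH2 x'))⟫_ℂ = 0)
    {c : ℕ → E →L[ℂ] F} (hc : ∀ (m : ℕ) x, coeffL2 F m (X (constH2 x) : L2 F) = c m x) :
    IsContractiveAnalytic (fun z : ℂ => ∑' m, z ^ m • c m) := by
  have hXx : ∀ x, ‖X (constH2 x)‖ ≤ ‖x‖ := fun x => (hX _).trans (norm_constH2 x).le
  have hc1 : ∀ m, ‖c m‖ ≤ 1 := fun m => by
    refine ContinuousLinearMap.opNorm_le_bound _ zero_le_one fun x => ?_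
    rw [← hc, one_mul]
    exact (norm_coeffL2_le _ _).trans (hXx x)
  refine ⟨differentiableOn_tsum_pow_smul hc1, fun z hz => ?_⟩
  rw [mem_ball_zero_iff] at hz
  refine ContinuousLinearMap.opNorm_le_bound _ zero_le_one fun x => ?_
  have hs : Summable (fun m => z ^ m • c m) := by
    refine Summable.of_norm ?_
    simpa only [norm_smul, norm_pow] using summable_pow_mul_norm hc1 (norm_nonneg z) hz
  have h1 : HasSum (fun m => z ^ m • c m x) ((∑' m, z ^ m • c m) x) :=
    hasSum_clm_apply hs.hasSum x
  simp only [← hc] at h1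
  rw [one_mul]
  exact (norm_tsum_coeffL2_le (hw x x) hz h1).trans (hXx x)

theorem adjoint_minus (Φ : OpLInfty E F) (z : ℂ) :
    (Φ.minus z)† = ∑' m : ℕ, z ^ m • (Φ.coeff (-(m : ℤ)))† := by
  -- An equivalence commutes with `tsum` without a summability hypothesis.
  let L : (E →L[ℂ] F) ≃L⋆[ℂ] F →L[ℂ] E := ContinuousLinearMap.adjoint.toContinuousLinearEquiv
  have h : L (∑' m : ℕ, (conj z) ^ m • Φ.coeff (-(m : ℤ))) =
    ∑' m : ℕ, L ((conj z) ^ m • Φ.coeff (-(m : ℤ))) := L.map_tsum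
  refine h.trans (tsum_congr fun m => ?_)
  refine (map_smulₛₗ L _ _).trans ?_
  rw [map_pow, Complex.conj_conj]
  rfl

/-! ### Constancy on the boundary -/

theorem inner_adjoint_comp_self {H K : Type*} [NormedAddCommGroup H] [InnerProductSpace ℂ H]
    [CompleteSpace H] [NormedAddCommGroup K] [InnerProductSpace ℂ K] [CompleteSpace K]
    (Y : H →L[ℂ] K) (x x' : H) : ⟪Y x, Y x'⟫_ℂ = ⟪x, (Y† ∘L Y) x'⟫_ℂ := by
  rw [ContinuousLinearMap.comp_apply, ContinuousLinearMap.adjoint_inner_right]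

/-- The n-th coefficient of ⟪θ x, θ x'⟫ is ⟪W x, e^{−int} W x'⟫, zero for n ≠ 0. Measurability comes
from W, so θ may be a pointwise adjoint. -/
theorem ae_adjoint_comp_self_eq [TopologicalSpace.SeparableSpace E] {θ : Torus → E →L[ℂ] F}
    {W : E → H2 F} (hθ : ∀ x, ∀ᵐ t ∂torusMeasure, θ t x = (W x : L2 F) t)
    (hbdd : ∃ C : ℝ, ∀ᵐ t ∂torusMeasure, ‖θ t‖ ≤ C)
    (hw : ∀ x x' k, ⟪W x, (shift F)^[k + 1] (W x')⟫_ℂ = 0) {A : E →L[ℂ] E}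
    (hA : ∀ x x', ⟪W x, W x'⟫_ℂ = ⟪x, A x'⟫_ℂ) :
    ∀ᵐ t ∂torusMeasure, (θ t)† ∘L θ t = A := by
  have : SecondCountableTopology E := UniformSpace.secondCountable_of_separable E
  obtain ⟨C, hC⟩ := hbdd
  have hentry : ∀ x x', ∀ᵐ t ∂torusMeasure, ⟪θ t x, θ t x'⟫_ℂ = ⟪x, A x'⟫_ℂ := by
    intro x x'
    have hae : (fun t => ⟪θ t x, θ t x'⟫_ℂ) =ᵐ[torusMeasure]
        fun t => ⟪(W x : L2 F) t, (W x' : L2 F) t⟫_ℂ := by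
      filter_upwards [hθ x, hθ x'] with t h1 h2
      rw [h1, h2]
    have hmem : MemLp (fun t => ⟪θ t x, θ t x'⟫_ℂ) 2 torusMeasure := by
      refine MemLp.of_bound (AEStronglyMeasurable.congr ?_ hae.symm) ((C * ‖x‖) * (C * ‖x'‖)) ?_
      · exact (Lp.aestronglyMeasurable _).inner (Lp.aestronglyMeasurable _)
      · filter_upwards [hC] with t ht
        refine (norm_inner_le_norm _ _).trans ?_
        have h1 := (θ t).le_of_opNorm_le ht x
        have h2 := (θ t).le_of_opNorm_le ht x'
        exact mul_le_mul h1 h2 (norm_nonneg _) ((norm_nonneg _).trans h1)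
    refine ae_eq_of_fourierCoeff_eq hmem (memLp_const _) fun n => ?_
    rw [fourierCoeff_congr_ae hae, fourierCoeff_const]
    have hin : fourierCoeff (fun t => ⟪(W x : L2 F) t, (W x' : L2 F) t⟫_ℂ) n =
        ⟪(W x : L2 F), mulFourier (-n) (W x' : L2 F)⟫_ℂ := by
      rw [L2.inner_def]
      refine integral_congr_ae ?_
      filter_upwards [coeFn_mulFourier (-n) (W x' : L2 F)] with t ht
      rw [ht, inner_smul_right, smul_eq_mul]
    have hshift : ∀ (k : ℕ) x x',
        ⟪(W x : L2 F), mulFourier ((k + 1 : ℕ) : ℤ) (W x' : L2 F)⟫_ℂ = 0 := by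
      intro k x x'
      rw [← coe_shift_pow, ← Submodule.coe_inner]
      exact hw x x' k
    rw [hin]
    rcases lt_trichotomy n 0 with hn | rfl | hn
    · obtain ⟨k, hk⟩ : ∃ k : ℕ, -n = (k + 1 : ℕ) := ⟨(-n - 1).toNat, by omega⟩
      rw [if_neg hn.ne, hk, hshift]
    · rw [if_pos rfl, neg_zero, mulFourier_zero, ← Submodule.coe_inner]
      exact hA x x'
    · obtain ⟨k, hk⟩ : ∃ k : ℕ, n = (k + 1 : ℕ) := ⟨(n - 1).toNat, by omega⟩
      rw [if_neg hn.ne', ← inner_mulFourier_mulFourier n, mulFourier_mulFourier, add_neg_cancel,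
        mulFourier_zero, ← inner_conj_symm, hk, hshift, map_zero]
  have hvec : ∀ x', ∀ᵐ t ∂torusMeasure, (θ t)† (θ t x') = A x' := by
    intro x'
    have h := ae_eq_zero_of_forall_inner (𝕜 := ℂ) (μ := torusMeasure)
      (f := fun t => (θ t)† (θ t x') - A x') fun x => by
        filter_upwards [hentry x x'] with t ht
        rw [inner_sub_right, ContinuousLinearMap.adjoint_inner_right, ht, sub_self, Pi.zero_apply]
    filter_upwards [h] with t ht
    exact sub_eq_zero.1 ht
  -- The exceptional null set depends on the vector; a dense sequence gives a common one.
  have hall : ∀ᵐ t ∂torusMeasure, ∀ i : ℕ,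
      (θ t)† (θ t (TopologicalSpace.denseSeq E i)) = A (TopologicalSpace.denseSeq E i) :=
    ae_all_iff.2 fun i => hvec _
  filter_upwards [hall] with t ht
  refine DFunLike.coe_injective ?_
  exact (TopologicalSpace.denseRange_denseSeq E).equalizer ((θ t)† ∘L θ t).continuous A.continuous
    (funext ht)

/-! ### Identification of the boundary functions -/

theorem ae_boundary_plus_apply [TopologicalSpace.SeparableSpace F] {Φ φ : OpLInfty E F}
    (hφ : ∀ n, φ.coeff n = if 0 ≤ n then Φ.coeff n else 0) (x : E) :
    ∀ᵐ t ∂torusMeasure, φ.toFun t x = (toeplitz Φ (constH2 x) : L2 F) t := by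
  have h : laurent φ (constL2 x) = (toeplitz Φ (constH2 x) : L2 F) := by
    refine L2.ext_coeff fun n => ?_
    rw [coeffL2_laurent_constL2, hφ]
    by_cases hn : 0 ≤ n
    · lift n to ℕ using hn
      rw [coeffL2_toeplitz_constH2, if_pos (by omega)]
    · rw [if_neg hn, (toeplitz Φ (constH2 x)).2 n (by omega)]
      rfl
  rw [← h]
  filter_upwards [coeFn_laurent φ (constL2 x), coeFn_constL2 x] with t h1 h2
  rw [h1, h2]

theorem fourierCoeff_conj (f : Torus → ℂ) (n : ℤ) :
    fourierCoeff (fun t => conj (f t)) n = conj (fourierCoeff f (-n)) := by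
  rw [fourierCoeff, fourierCoeff, ← integral_conj]
  refine integral_congr_ae (Eventually.of_forall fun t => ?_)
  simp only [smul_eq_mul, map_mul, neg_neg, ← fourier_neg]

/-- Taking adjoints is not strongly continuous, so the identification goes through the scalar
entries ⟪y, φ(t) x⟫ and their Fourier coefficients. -/
theorem ae_adjoint_boundary_minus_apply [TopologicalSpace.SeparableSpace E] {Φ φ : OpLInfty E F}
    (hφ : ∀ n, φ.coeff n = if n ≤ 0 then Φ.coeff n else 0) (y : F) :
    ∀ᵐ t ∂torusMeasure, ((φ.toFun t)†) y = (((toeplitz Φ)†) (constH2 y) : L2 E) t := by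
  have : SecondCountableTopology E := UniformSpace.secondCountable_of_separable E
  set W : H2 E := ((toeplitz Φ)†) (constH2 y) with hW
  have hx : ∀ x : E, ∀ᵐ t ∂torusMeasure, ⟪y, φ.toFun t x⟫_ℂ = conj ⟪x, (W : L2 E) t⟫_ℂ := by
    intro x
    obtain ⟨C, hC⟩ := φ.bdd
    have hmem : MemLp (fun t => φ.toFun t x) 2 torusMeasure := by
      refine MemLp.of_bound (φ.meas x) (C * ‖x‖) ?_
      filter_upwards [hC] with t ht
      exact (φ.toFun t).le_of_opNorm_le ht x
    have hmem2 : MemLp (fun t => ⟪x, (W : L2 E) t⟫_ℂ) 2 torusMeasure :=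
      (Lp.memLp (W : L2 E)).const_inner x
    refine ae_eq_of_fourierCoeff_eq (hmem.const_inner y) hmem2.star fun n => ?_
    rw [← inner_fourierCoeff (φ.integrable_apply x)]
    refine Eq.trans ?_ (fourierCoeff_conj _ _).symm
    rw [← inner_fourierCoeff (integrable_of_L2 _), ← coeffL2_apply]
    change ⟪y, φ.coeff n x⟫_ℂ = _
    rw [hφ]
    by_cases hn : n ≤ 0
    · obtain ⟨k, rfl⟩ : ∃ k : ℕ, n = -(k : ℤ) := ⟨(-n).toNat, by omega⟩
      rw [if_pos hn, neg_neg, hW, coeffL2_adjoint_toeplitz_constH2,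
        ContinuousLinearMap.adjoint_inner_right, inner_conj_symm]
    · rw [if_neg hn, W.2 _ (by omega), inner_zero_right, map_zero]
      exact inner_zero_right _
  have h := ae_eq_zero_of_forall_inner (𝕜 := ℂ) (μ := torusMeasure)
    (f := fun t => ((φ.toFun t)†) y - (W : L2 E) t) fun x => by
      filter_upwards [hx x] with t ht
      rw [inner_sub_right, ContinuousLinearMap.adjoint_inner_right, ← inner_conj_symm, ht,
        Complex.conj_conj, sub_self, Pi.zero_apply]
  filter_upwards [h] with t ht
  exact sub_eq_zero.1 ht

/-! ### Products of coefficients -/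

/-- `IsToeplitzFor.inner_apply_sub` at h = S^n x, where the defect is the constant given by the
first vector. -/
theorem inner_coeff_eq_zero [TopologicalSpace.SeparableSpace F] {X : H2 E →L[ℂ] H2 F}
    (hX : IsToeplitzFor (shift E) (shift F) X) (hX' : IsAlgPartialIsometry X) (x x' : E)
    (m n : ℕ) :
    ⟪coeffL2 F 0 (X ((shift E)^[n + 1] (constH2 x)) : L2 F),
      coeffL2 F (m + 1 : ℕ) (X (constH2 x') : L2 F)⟫_ℂ = 0 := by
  have h := hX.inner_apply_sub hX' norm_shift norm_shift (inner_constH2_shift x')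
    ((shift E)^[n] (constH2 x)) m
  rw [hX.apply_shift_sub_shift_apply, ← Function.iterate_succ_apply' (shift E)] at h
  rw [← inner_shift_pow_constH2]
  exact inner_eq_zero_symm.1 h

end ToeplitzPI

end

theorem mainTheorem6 {E F : Type*}
    [NormedAddCommGroup E] [InnerProductSpace ℂ E] [CompleteSpace E]
    [TopologicalSpace.SeparableSpace E]
    [NormedAddCommGroup F] [InnerProductSpace ℂ F] [CompleteSpace F]
    [TopologicalSpace.SeparableSpace F]
    (Φ : ToeplitzPI.OpLInfty E F) (hΦ : Φ.MemHInftyAddConj)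
    (hne : ToeplitzPI.toeplitz Φ ≠ 0)
    (hpi : ToeplitzPI.IsPartialIsometry (ToeplitzPI.toeplitz Φ)) :
    (ToeplitzPI.IsContractiveAnalytic Φ.plus ∧
      ∃ φ : ToeplitzPI.Torus → E →L[ℂ] F, ToeplitzPI.IsBoundaryFunction Φ.plus φ ∧
        ∃ A : E →L[ℂ] E, ∀ᵐ t ∂ToeplitzPI.torusMeasure,
          ContinuousLinearMap.adjoint (φ t) ∘L φ t = A) ∧
    (ToeplitzPI.IsContractiveAnalytic
        (fun z => ContinuousLinearMap.adjoint (Φ.minus z)) ∧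
      ∃ φ : ToeplitzPI.Torus → E →L[ℂ] F, ToeplitzPI.IsBoundaryFunction Φ.minus φ ∧
        ∃ B : F →L[ℂ] F, ∀ᵐ t ∂ToeplitzPI.torusMeasure,
          φ t ∘L ContinuousLinearMap.adjoint (φ t) = B) ∧
    ∀ m n : ℕ, 1 ≤ m → 1 ≤ n →
      ContinuousLinearMap.adjoint (Φ.coeff (m : ℤ)) ∘L Φ.coeff (-(n : ℤ)) = 0 ∧
      Φ.coeff (-(n : ℤ)) ∘L ContinuousLinearMap.adjoint (Φ.coeff (m : ℤ)) = 0 := by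
  open ToeplitzPI in
  have hT := hpi.isAlg
  have hTS := isToeplitzFor_toeplitz Φ
  have hw : ∀ x x' k, ⟪toeplitz Φ (constH2 x), (shift F)^[k + 1] (toeplitz Φ (constH2 x'))⟫_ℂ = 0 :=
    fun x x' k => hTS.inner_apply_pow hT norm_shift norm_shift (inner_constH2_shift x) _ k
  have hw' : ∀ y y' k, ⟪ContinuousLinearMap.adjoint (toeplitz Φ) (constH2 y),
      (shift E)^[k + 1] (ContinuousLinearMap.adjoint (toeplitz Φ) (constH2 y'))⟫_ℂ = 0 :=
    fun y y' k => hTS.adjoint.inner_apply_pow hT.adjoint norm_shift norm_shift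
      (inner_constH2_shift y) _ k
  refine ⟨⟨?_, ?_⟩, ⟨?_, ?_⟩, ?_⟩
  · exact isContractiveAnalytic_tsum hT.norm_apply_le hw (coeffL2_toeplitz_constH2 Φ)
  · obtain ⟨φ, hφ, hc⟩ := hΦ.exists_boundary_plus
    -- The constant is the Gram operator of x ↦ T x on constants.
    refine ⟨φ.toFun, hφ, ContinuousLinearMap.adjoint (toeplitz Φ ∘L constH2L E) ∘L
      (toeplitz Φ ∘L constH2L E), ?_⟩
    exact ae_adjoint_comp_self_eq (ae_boundary_plus_apply hc) φ.bdd hw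
      (inner_adjoint_comp_self (toeplitz Φ ∘L constH2L E))
  · have h := isContractiveAnalytic_tsum hT.adjoint.norm_apply_le hw'
      (coeffL2_adjoint_toeplitz_constH2 Φ)
    simp only [adjoint_minus]
    exact h
  · obtain ⟨φ, hφ, hc⟩ := hΦ.exists_boundary_minus
    refine ⟨φ.toFun, hφ, ContinuousLinearMap.adjoint
      (ContinuousLinearMap.adjoint (toeplitz Φ) ∘L constH2L F) ∘L
      (ContinuousLinearMap.adjoint (toeplitz Φ) ∘L constH2L F), ?_⟩
    have h := ae_adjoint_comp_self_eq
      (θ := fun t => ContinuousLinearMap.adjoint (φ.toFun t))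
      (A := ContinuousLinearMap.adjoint
        (ContinuousLinearMap.adjoint (toeplitz Φ) ∘L constH2L F) ∘L
        (ContinuousLinearMap.adjoint (toeplitz Φ) ∘L constH2L F))
      (ae_adjoint_boundary_minus_apply hc)
      (by simpa only [LinearIsometryEquiv.norm_map] using φ.bdd) hw'
      (inner_adjoint_comp_self (ContinuousLinearMap.adjoint (toeplitz Φ) ∘L constH2L F))
    simpa only [ContinuousLinearMap.adjoint_adjoint] using h
  · intro m n hm hn
    obtain ⟨m, rfl⟩ := Nat.exists_eq_add_of_le' hm
    obtain ⟨n, rfl⟩ := Nat.exists_eq_add_of_le' hn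
    constructor
    · ext x
      refine ext_inner_left ℂ fun x' => ?_
      have h := inner_coeff_eq_zero hTS hT x x' m n
      have h0 := coeffL2_toeplitz_shift_pow Φ 0 (n + 1) x
      rw [Nat.cast_zero, zero_sub] at h0
      rw [h0, coeffL2_toeplitz_constH2] at h
      rw [ContinuousLinearMap.comp_apply, ContinuousLinearMap.adjoint_inner_right,
        ← inner_conj_symm, h, map_zero, zero_apply, inner_zero_right]
    · ext y
      refine ext_inner_left ℂ fun y' => ?_
      -- For T† the indices m and n exchange roles.
      have h := inner_coeff_eq_zero hTS.adjoint hT.adjoint y y' n m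
      rw [coeffL2_zero_adjoint_toeplitz_shift_pow, coeffL2_adjoint_toeplitz_constH2,
        ContinuousLinearMap.adjoint_inner_right] at h
      rw [ContinuousLinearMap.comp_apply, ← inner_conj_symm, h, map_zero,
        zero_apply, inner_zero_right]
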